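/- **Setting.** Let $n\ge 1$, let $V$ be a $\mathbb{Q}$-vector space of dimension $n$, let $L=\bigoplus_{i=1}^n\mathbb{Z}e_i\subset V$ be a lattice with fixed $\mathbb{Z}$-basis $e_1,\dots,e_n$ (a $\mathbb{Q}$-basis of $V$), and let $\Lambda=\mathrm{Hom}(L,\mathbb{Z})\subset V^\vee=\mathrm{Hom}_{\mathbb{Q}}(V,\mathbb{Q})$. Determinants of $n$ linear forms are taken in the dual basis of $V^\vee$. Write $x$ for the indeterminate linear form on $V$ with coordinates $x(e_1),\dots,x(e_n)$, and $\mathbb{Q}[w](x)$ for the ring of functions polynomial in $w$ and rational in $x$, with rational coefficients. Let $B^*_{n,m}(z,\omega_1,\dots,\omega_n)$ be defined by $e^{zt}\prod_{j=1}^n\frac{\omega_jt}{e^{\omega_jt}-1}=\sum_{m\ge0}B^*_{n,m}(z,\omega)\frac{t^m}{m!}$. If $a_1,\dots,a_n\in V^\vee$ are linearly independent, there is a unique family $\alpha_1,\dots,\alpha_n$ of primitive vectors of $L$ with $a_j(\alpha_j)>0$ and $a_k(\alpha_j)=0$ for $k\ne j$. For $v\in V/L$ let $F(\underline a,v)$ be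 the finite set of $\delta\in v+L$ with $0\le a_j(\delta)<a_j(\alpha_j)$ for all $1\le j\le n$, and define in $\mathbb{Q}[w](x)$ $$B_{n,a_1,\dots,a_n}(v)=\Big(\prod_{j=1}^n x(\alpha_j)\Big)^{-1}\,\frac{\mathrm{sign}\big((-1)^n\det(a_1,\dots,a_n)\big)}{n!}\sum_{\delta\in F(\underline a,v)}B^*_{n,n}\big(w+x(\delta),x(\alpha_1),\dots,x(\alpha_n)\big).$$ If $a_1,\dots,a_n$ are linearly dependent, set $B_{n,a_1,\dots,a_n}(v)=0$. If $a_0,\dots,a_n\in V^\vee$ have rank $n$, their standard relation is the unique relation $\sum_{j=0}^n\lambda_ja_j=0$ with $\lambda\in\mathbb{Q}^{n+1}\setminus\{0\}$ such that $\#\{j:\lambda_j<0\}\le\#\{j:\lambda_j>0\}$, the first non-zero coefficient has absolute value $1$, and, if the two cardinalities are equal, the first non-zero coefficient is negative. Put $k^-(a_0,\dots,a_n)=\#\{j:\lambda_j<0\}$. The family $a_0,\dots,a_n$ is in general position if each of its subfamilies of size at most $n$ is linearly independent (for $n\ge1$ it then has rank $n$). **Proposition 14.** Let $a_0,\dots,a_n$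 be $n+1$ non-zero linear forms in $\Lambda$ and let $v\in V/L$. 1. Suppose that $\mathrm{rank}(a_0,\dots,a_n)\le n-1$, or that $\mathrm{rank}(a_0,\dots,a_n)=n$ and $k^-(a_0,\dots,a_n)>0$. Then, in $\mathbb{Q}[w](x)$, $$\sum_{j=0}^n(-1)^jB_{n,a_0,\dots,\widehat{a_j},\dots,a_n}(v)=0.$$ 2. Suppose that $a_0,\dots,a_n$ are in general position with $k^-(a_0,\dots,a_n)=0$. Then, in $\mathbb{Q}[w](x)$, $$\sum_{j=0}^n(-1)^jB_{n,a_0,\dots,\widehat{a_j},\dots,a_n}(v)=\begin{cases}\mathrm{sign}\,\det(a_1,\dots,a_n)&\text{if }v\in L\ (\text{i.e. }v=0\text{ in }V/L),\\0&\text{otherwise.}\end{cases}$$ -/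

import Mathlib

open Module

namespace GeomBernoulli

/-! ## The lattice `L`, its dual `Λ` and primitive vectors

`V` is a `ℚ`-vector space of dimension `n` and `B` is a basis of `V` which is also the chosen
`ℤ`-basis of the lattice `L`. -/

section Lattice

variable {n : ℕ} {V : Type*} [AddCommGroup V] [Module ℚ V]

/-- The lattice `L` of rank `n` in `V` with `ℤ`-basis `B`. -/
def lattice (B : Basis (Fin n) ℚ V) : Submodule ℤ V := Submodule.span ℤ (Set.range B)

/-- The dual lattice `Λ = Hom(L, ℤ)`, seen inside the dual of `V`: the linear forms on `V` that
are integral on `L`. -/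
def dualLattice (B : Basis (Fin n) ℚ V) : Submodule ℤ (Dual ℚ V) where
  carrier := {f | ∀ l ∈ lattice B, ∃ k : ℤ, f l = k}
  add_mem' := by
    intro f g hf hg l hl
    obtain ⟨k, hk⟩ := hf l hl
    obtain ⟨m, hm⟩ := hg l hl
    exact ⟨k + m, by simp [hk, hm]⟩
  zero_mem' := fun l _ => ⟨0, by simp⟩
  smul_mem' := by
    intro c f hf l hl
    obtain ⟨k, hk⟩ := hf l hl
    exact ⟨c * k, by simp [hk]⟩

/-- `w` is a primitive vector of the lattice `L`. -/
def IsPrimitiveVector (L : Submodule ℤ V) (w : V) : Prop :=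
  w ∈ L ∧ ∀ m : ℕ, 1 ≤ m → ∀ w' ∈ L, w = m • w' → m = 1

/-- `α` is a positive dual family to `a` in `L` that consists of primitive vectors. -/
def IsPrimitivePositiveDual (B : Basis (Fin n) ℚ V) (a : Fin n → Dual ℚ V) (α : Fin n → V) :
    Prop :=
  ∀ j, IsPrimitiveVector (lattice B) (α j) ∧ 0 < a j (α j) ∧ ∀ k, k ≠ j → a k (α j) = 0

theorem mem_lattice (B : Basis (Fin n) ℚ V) (x : V) :
    x ∈ lattice B ↔ ∀ i, ∃ z : ℤ, (z : ℚ) = B.repr x i := by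
  rw [lattice, Basis.mem_span_iff_repr_mem]
  simp

theorem exists_primitive_smul (B : Basis (Fin n) ℚ V) (x : V) (hx : x ≠ 0) :
    ∃ q : ℚ, 0 < q ∧ IsPrimitiveVector (lattice B) (q • x) := by
  classical
  set N : ℕ := ∏ i, (B.repr x i).den with hN
  have hNpos : 0 < N := Finset.prod_pos fun i _ => (B.repr x i).den_pos
  have hz : ∀ i, ∃ z : ℤ, (z : ℚ) = N * B.repr x i := by
    intro i
    obtain ⟨c, hc⟩ : (B.repr x i).den ∣ N := Finset.dvd_prod_of_mem _ (Finset.mem_univ i)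
    refine ⟨c * (B.repr x i).num, ?_⟩
    have := Rat.den_mul_eq_num (B.repr x i)
    rw [hc]
    push_cast
    linear_combination (-(c : ℚ)) * this
  choose z hz using hz
  have hne : (Finset.univ : Finset (Fin n)).Nonempty := by
    by_contra h
    apply hx
    apply B.repr.injective
    ext i
    exact absurd ⟨i, Finset.mem_univ i⟩ h
  obtain ⟨g, hg, hg1⟩ := Finset.extract_gcd z hne
  set d : ℤ := Finset.univ.gcd z with hd
  have hd0 : d ≠ 0 := by
    intro h0
    apply hx
    apply B.repr.injective
    ext i
    have h1 := hg i (Finset.mem_univ i)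
    rw [h0, zero_mul] at h1
    have h2 := hz i
    rw [h1] at h2
    have hN' : (N : ℚ) ≠ 0 := by positivity
    simpa [hN'] using h2.symm
  have hdpos : 0 < d := lt_of_le_of_ne
    (by rw [hd, ← Finset.normalize_gcd, ← Int.abs_eq_normalize]; exact abs_nonneg _) hd0.symm
  have hdq : (0 : ℚ) < d := by exact_mod_cast hdpos
  have hcoord : ∀ i, B.repr (((N : ℚ) / d) • x) i = g i := by
    intro i
    have h1 := hg i (Finset.mem_univ i)
    have h2 := hz i
    rw [h1] at h2
    push_cast at h2
    simp only [map_smul, Finsupp.smul_apply, smul_eq_mul]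
    field_simp
    linarith
  refine ⟨N / d, by positivity, (mem_lattice B _).2 fun i => ⟨g i, (hcoord i).symm⟩, ?_⟩
  intro m hm w' hw' h
  have hdvd : (m : ℤ) ∣ Finset.univ.gcd g := by
    apply Finset.dvd_gcd
    intro i _
    obtain ⟨k, hk⟩ := (mem_lattice B w').1 hw' i
    refine ⟨k, ?_⟩
    have := hcoord i
    rw [h] at this
    rw [map_nsmul, Finsupp.smul_apply, ← hk, nsmul_eq_mul] at this
    exact_mod_cast this.symm
  rw [hg1] at hdvd
  exact Nat.dvd_one.1 (by exact_mod_cast hdvd)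

theorem den_eq_one_of_primitive (B : Basis (Fin n) ℚ V) {x : V}
    (hx : IsPrimitiveVector (lattice B) x) (q : ℚ) (hq : q • x ∈ lattice B) : q.den = 1 := by
  have hden : (q.den : ℚ) ≠ 0 := by exact_mod_cast q.den_nz
  refine hx.2 q.den q.den_pos ((q.den : ℚ)⁻¹ • x) ((mem_lattice B _).2 fun i => ?_) ?_
  · obtain ⟨z, hz⟩ := (mem_lattice B _).1 hx.1 i
    obtain ⟨y, hy⟩ := (mem_lattice B _).1 hq i
    rw [map_smul, Finsupp.smul_apply, ← hz, smul_eq_mul] at hy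
    have h1 : q.num * z = q.den * y := by
      have h3 : ((q.num * z : ℤ) : ℚ) = ((q.den * y : ℤ) : ℚ) := by
        push_cast
        rw [hy, ← Rat.den_mul_eq_num q]
        ring
      exact_mod_cast h3
    have h2 : (q.den : ℤ) ∣ z := by
      apply IsCoprime.dvd_of_dvd_mul_left _ (Dvd.intro _ h1.symm)
      rw [Int.isCoprime_iff_gcd_eq_one, Int.gcd_comm]
      exact q.reduced
    obtain ⟨c, hc⟩ := h2
    refine ⟨c, ?_⟩
    rw [map_smul, Finsupp.smul_apply, ← hz, hc, smul_eq_mul]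
    push_cast
    field_simp
  · rw [← Nat.cast_smul_eq_nsmul ℚ, smul_smul, mul_inv_cancel₀ hden, one_smul]

/-- A basis of the dual space separates the points of `V`. -/
theorem pi_bijective (B : Basis (Fin n) ℚ V) (a : Fin n → Dual ℚ V)
    (ha : LinearIndependent ℚ a) : Function.Bijective (LinearMap.pi a) := by
  have : FiniteDimensional ℚ V := B.finiteDimensional_of_finite
  have hfr : finrank ℚ V = n := by simpa using finrank_eq_card_basis B
  have hinj : Function.Injective (LinearMap.pi a) := by
    rw [← LinearMap.ker_eq_bot, LinearMap.ker_eq_bot']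
    intro x hx
    rw [← Module.forall_dual_apply_eq_zero_iff ℚ]
    intro f
    have hspan : Submodule.span ℚ (Set.range a) = ⊤ :=
      ha.span_eq_top_of_card_eq_finrank' (by simp [Subspace.dual_finrank_eq, hfr])
    have hf : f ∈ Submodule.span ℚ (Set.range a) := hspan ▸ Submodule.mem_top
    induction hf using Submodule.span_induction with
    | mem f h => obtain ⟨i, rfl⟩ := h; exact congrFun hx i
    | zero => rfl
    | add f g _ _ hf hg => simp [hf, hg]
    | smul c f _ hf => simp [hf]
  exact ⟨hinj, (LinearMap.injective_iff_surjective_of_finrank_eq_finrank (by simp [hfr])).1 hinj⟩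

/-- A family of `n` linearly independent forms has exactly one primitive positive dual family. -/
theorem existsUnique_primitivePositiveDual (B : Basis (Fin n) ℚ V) (a : Fin n → Dual ℚ V)
    (ha : LinearIndependent ℚ a) : ∃! α : Fin n → V, IsPrimitivePositiveDual B a α := by
  classical
  obtain ⟨hinj, hsurj⟩ := pi_bijective B a ha
  have hex : ∀ j, ∃ x : V, IsPrimitiveVector (lattice B) x ∧ 0 < a j x ∧
      ∀ k, k ≠ j → a k x = 0 := by
    intro j
    obtain ⟨y, hy⟩ := hsurj (Pi.single j 1)
    have hyk : ∀ k, a k y = (Pi.single j 1 : Fin n → ℚ) k := fun k => congrFun hy k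
    have hy0 : y ≠ 0 := by
      rintro rfl
      simpa using hyk j
    obtain ⟨q, hq, hprim⟩ := exists_primitive_smul B y hy0
    refine ⟨q • y, hprim, by simp [hyk, hq], fun k hk => by simp [hyk, hk]⟩
  choose α hα using hex
  refine ⟨α, hα, ?_⟩
  intro α' hα'
  funext j
  obtain ⟨hp, hpos, hz⟩ := hα j
  obtain ⟨hp', hpos', hz'⟩ := hα' j
  set q : ℚ := a j (α' j) / a j (α j) with hq
  have hqpos : 0 < q := div_pos hpos' hpos
  have hqα : α' j = q • α j := by
    apply hinj
    funext k
    simp only [LinearMap.pi_apply, map_smul, smul_eq_mul]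
    by_cases hk : k = j
    · subst hk
      rw [hq]
      field_simp
    · rw [hz k hk, hz' k hk, mul_zero]
  have hqα' : α j = q⁻¹ • α' j := by
    rw [hqα, smul_smul, inv_mul_cancel₀ hqpos.ne', one_smul]
  have h1 : q.den = 1 := den_eq_one_of_primitive B hp q (hqα ▸ hp'.1)
  have h2 : q⁻¹.den = 1 := den_eq_one_of_primitive B hp' q⁻¹ (hqα' ▸ hp.1)
  rw [Rat.den_inv_of_ne_zero hqpos.ne'] at h2
  have hnum : q.num = 1 := by
    have := Rat.num_pos.2 hqpos
    omega
  have : q = 1 := by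
    rw [← Rat.num_div_den q, hnum, h1]
    norm_num
  rw [hqα, this, one_smul]

/-- The primitive positive dual family to `n` linearly independent linear forms. -/
noncomputable def primitivePositiveDual (B : Basis (Fin n) ℚ V) (a : Fin n → Dual ℚ V)
    (ha : LinearIndependent ℚ a) : Fin n → V :=
  (existsUnique_primitivePositiveDual B a ha).choose

theorem primitivePositiveDual_spec (B : Basis (Fin n) ℚ V) (a : Fin n → Dual ℚ V)
    (ha : LinearIndependent ℚ a) :
    IsPrimitivePositiveDual B a (primitivePositiveDual B a ha) :=
  (existsUnique_primitivePositiveDual B a ha).choose_spec.1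

/-- The set `F(a, v) = {δ ∈ v + L | 0 ≤ a_j(δ) < a_j(α_j) for all j}`, for `v ∈ V/L`. -/
def fundamentalSet (B : Basis (Fin n) ℚ V) (a : Fin n → Dual ℚ V) (α : Fin n → V)
    (v : V ⧸ lattice B) : Set V :=
  {δ | (lattice B).mkQ δ = v ∧ ∀ j, 0 ≤ a j δ ∧ a j δ < a j (α j)}

theorem fundamentalSet_finite (B : Basis (Fin n) ℚ V) (a : Fin n → Dual ℚ V)
    (ha : LinearIndependent ℚ a) (α : Fin n → V) (hα : IsPrimitivePositiveDual B a α)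
    (v : V ⧸ lattice B) : (fundamentalSet B a α v).Finite := by
  classical
  obtain ⟨hinj, -⟩ := pi_bijective B a ha
  obtain ⟨v₀, rfl⟩ := (lattice B).mkQ_surjective v
  set M : Fin n → ℚ := fun i => ∑ j, |B.repr (α j) i| with hM
  refine ((Set.finite_Icc (fun i => ⌈-M i - B.repr v₀ i⌉) (fun i => ⌊M i - B.repr v₀ i⌋)).image
    (fun z : Fin n → ℤ => v₀ + ∑ i, (z i : ℚ) • B i)).subset ?_
  rintro δ ⟨hδ, hb⟩
  have hmem : δ - v₀ ∈ lattice B := (Submodule.Quotient.eq _).1 hδ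
  choose z hz using (mem_lattice B _).1 hmem
  have hdec : δ = ∑ j, (a j δ / a j (α j)) • α j := by
    apply hinj
    funext k
    simp only [LinearMap.pi_apply, map_sum, map_smul, smul_eq_mul]
    rw [Finset.sum_eq_single k]
    · rw [div_mul_cancel₀ _ (hα k).2.1.ne']
    · intro j _ hj
      rw [(hα j).2.2 k hj.symm, mul_zero]
    · simp
  have hbound : ∀ i, |B.repr δ i| ≤ M i := by
    intro i
    conv_lhs => rw [hdec]
    simp only [map_sum, map_smul, Finsupp.coe_finsetSum, Finset.sum_apply, Finsupp.smul_apply,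
      smul_eq_mul]
    refine (Finset.abs_sum_le_sum_abs _ _).trans (Finset.sum_le_sum fun j _ => ?_)
    rw [abs_mul]
    have hp := (hα j).2.1
    have h1 : |a j δ / a j (α j)| ≤ 1 := by
      rw [abs_of_nonneg (div_nonneg (hb j).1 hp.le), div_le_one hp]
      exact (hb j).2.le
    exact mul_le_of_le_one_left (abs_nonneg _) h1
  have hzi : ∀ i, (z i : ℚ) = B.repr δ i - B.repr v₀ i := by
    intro i
    rw [hz i]
    simp
  refine ⟨z, ⟨fun i => ?_, fun i => ?_⟩, ?_⟩
  · show ⌈_⌉ ≤ z i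
    rw [Int.ceil_le, hzi]
    have := (abs_le.1 (hbound i)).1
    linarith
  · show z i ≤ ⌊_⌋
    rw [Int.le_floor, hzi]
    have := (abs_le.1 (hbound i)).2
    linarith
  · have h2 : ∑ i, (z i : ℚ) • B i = δ - v₀ := by
      conv_rhs => rw [← B.sum_repr (δ - v₀)]
      exact Finset.sum_congr rfl fun i _ => by rw [hz i]
    simp only [h2]
    abel

end Lattice

/-! ## Multiple Bernoulli polynomials -/

/-- The multiple Bernoulli polynomial `B*_{n,m}(z, ω)`, evaluated in a commutative `ℚ`-algebra. It
is given by the generating function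
`e^{zt} ∏_j (ω_j t / (e^{ω_j t} - 1)) = ∑_m B*_{n,m}(z, ω) t^m / m!`,
where `bernoulliPowerSeries` is the power series `t / (e^t - 1)`. -/
noncomputable def multipleBernoulli {A : Type*} [CommRing A] [Algebra ℚ A] {n : ℕ} (m : ℕ) (z : A)
    (ω : Fin n → A) : A :=
  (m.factorial : A) * PowerSeries.coeff m
    (PowerSeries.rescale z (PowerSeries.exp A) *
      ∏ j, PowerSeries.rescale (ω j) (bernoulliPowerSeries A))

/-! ## The geometric Bernoulli rational functions -/

/-- The polynomial ring `ℚ[x][w]`: the variables `X_i` are the values of the indeterminate linear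
form `x` on the vectors `e_i` of the basis of `L`, and the outer variable is `w`. -/
abbrev BernoulliPolynomials (n : ℕ) : Type := Polynomial (MvPolynomial (Fin n) ℚ)

/-- The ring `ℚ[w](x)` of functions that are polynomial in `w` and rational in `x`, with
coefficients in `ℚ`. -/
abbrev BernoulliFunctions (n : ℕ) : Type := Polynomial (FractionRing (MvPolynomial (Fin n) ℚ))

section Bernoulli

variable {n : ℕ} {V : Type*} [AddCommGroup V] [Module ℚ V]

/-- The value `x(δ)` of the indeterminate linear form `x` at a vector `δ` of `V`. -/
noncomputable def formalValue (B : Basis (Fin n) ℚ V) (δ : V) : MvPolynomial (Fin n) ℚ :=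
  ∑ i, MvPolynomial.C (B.repr δ i) * MvPolynomial.X i

/-- The sign in `{-1, 0, 1}` of the determinant of `n` linear forms, computed in the basis dual to
`B`. -/
noncomputable def signDet (B : Basis (Fin n) ℚ V) (a : Fin n → Dual ℚ V) : ℤ :=
  (SignType.sign (B.dualBasis.det a) : ℤ)

/-- The geometric Bernoulli polynomial
`B*_{n,a}(v)(w, x) = (ε / n!) ∑_{δ ∈ F(a, v)} B*_{n,n}(w + x(δ), x(α_1), …, x(α_n))`, where `ε` is
the sign of `(-1)^n det(a_1, …, a_n)` (the sum is over a finite set). -/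
noncomputable def geometricBernoulliPolynomial (B : Basis (Fin n) ℚ V) (a : Fin n → Dual ℚ V)
    (ha : LinearIndependent ℚ a) (v : V ⧸ lattice B) : BernoulliPolynomials n :=
  ((((-1) ^ n * signDet B a : ℤ) : ℚ) / (n.factorial : ℚ)) •
    ∑ δ ∈ (fundamentalSet_finite B a ha _ (primitivePositiveDual_spec B a ha) v).toFinset,
      multipleBernoulli n (Polynomial.X + Polynomial.C (formalValue B δ))
        (fun j => Polynomial.C (formalValue B (primitivePositiveDual B a ha j)))

open Classical in
/-- The geometric Bernoulli rational function
`B_{n,a}(v)(w, x) = (∏_j x(α_j))⁻¹ B*_{n,a}(v)(w, x)` in `ℚ[w](x)`, equal to `0` by convention when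
the forms `a_1, …, a_n` are linearly dependent. -/
noncomputable def geometricBernoulli (B : Basis (Fin n) ℚ V) (a : Fin n → Dual ℚ V)
    (v : V ⧸ lattice B) : BernoulliFunctions n :=
  if ha : LinearIndependent ℚ a then
    Polynomial.C (∏ j, algebraMap (MvPolynomial (Fin n) ℚ) (FractionRing (MvPolynomial (Fin n) ℚ))
        (formalValue B (primitivePositiveDual B a ha j)))⁻¹ *
      (geometricBernoulliPolynomial B a ha v).map (algebraMap _ _)
  else 0

end Bernoulli

/-! ## Rank, general position and the standard relation -/

section Relation

variable {W : Type*} [AddCommGroup W] [Module ℚ W]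

/-- The rank of a finite family of vectors. -/
noncomputable def rank {ι : Type*} (a : ι → W) : ℕ := Set.finrank ℚ (Set.range a)

/-- A family of vectors of a space of dimension `d` is in general position if all its subfamilies
of size at most `d` are free. -/
def InGeneralPosition {ι : Type*} (a : ι → W) : Prop :=
  ∀ s : Finset ι, s.card ≤ finrank ℚ W → LinearIndependent ℚ (fun i : s => a i)

/-- The number of negative coefficients. -/
def numNeg {m : ℕ} (c : Fin (m + 1) → ℚ) : ℕ := (Finset.univ.filter fun j => c j < 0).card

/-- The number of positive coefficients. -/
def numPos {m : ℕ} (c : Fin (m + 1) → ℚ) : ℕ := (Finset.univ.filter fun j => 0 < c j).card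

/-- The coefficient `c l` is the first non-zero one. -/
def IsFirstNonzero {m : ℕ} (c : Fin (m + 1) → ℚ) (l : Fin (m + 1)) : Prop :=
  c l ≠ 0 ∧ ∀ i < l, c i = 0

/-- `∑ c_j a_j = 0` is the standard non-trivial relation among `a_0, …, a_m`. -/
structure IsStandardRelation {m : ℕ} (a : Fin (m + 1) → W) (c : Fin (m + 1) → ℚ) : Prop where
  relation : ∑ j, c j • a j = 0
  ne_zero : c ≠ 0
  numNeg_le : numNeg c ≤ numPos c
  first_neg : numNeg c = numPos c → ∀ l, IsFirstNonzero c l → c l < 0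
  first_abs : ∀ l, IsFirstNonzero c l → |c l| = 1

theorem exists_isFirstNonzero {m : ℕ} (c : Fin (m + 1) → ℚ) (hc : c ≠ 0) :
    ∃ l, IsFirstNonzero c l := by
  classical
  have hne : (Finset.univ.filter fun j => c j ≠ 0).Nonempty := by
    obtain ⟨i, hi⟩ := Function.ne_iff.1 hc
    exact ⟨i, by simpa using hi⟩
  refine ⟨_, (Finset.mem_filter.1 (Finset.min'_mem _ hne)).2, fun i hi => ?_⟩
  by_contra h
  exact absurd (Finset.min'_le _ i (by simp [h])) (not_le.2 hi)

theorem numNeg_neg {m : ℕ} (c : Fin (m + 1) → ℚ) : numNeg (-c) = numPos c := by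
  simp [numNeg, numPos]

theorem numPos_neg {m : ℕ} (c : Fin (m + 1) → ℚ) : numPos (-c) = numNeg c := by
  simp [numNeg, numPos]

theorem IsFirstNonzero.smul {m : ℕ} {c : Fin (m + 1) → ℚ} {l : Fin (m + 1)}
    (h : IsFirstNonzero c l) {q : ℚ} (hq : q ≠ 0) : IsFirstNonzero (q • c) l :=
  ⟨by simpa [hq] using h.1, fun i hi => by simp [h.2 i hi]⟩

theorem IsFirstNonzero.unique {m : ℕ} {c : Fin (m + 1) → ℚ} {l l' : Fin (m + 1)}
    (h : IsFirstNonzero c l) (h' : IsFirstNonzero c l') : l = l' := by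
  rcases lt_trichotomy l l' with hl | hl | hl
  · exact absurd (h'.2 l hl) h.1
  · exact hl
  · exact absurd (h.2 l' hl) h'.1

/-- A family of `m + 1` vectors of rank `m` has exactly one standard non-trivial relation. -/
theorem existsUnique_standardRelation {m : ℕ} (a : Fin (m + 1) → W) (ha : rank a = m) :
    ∃! c : Fin (m + 1) → ℚ, IsStandardRelation a c := by
  classical
  set T := Fintype.linearCombination ℚ a with hT
  have hker : finrank ℚ (LinearMap.ker T) = 1 := by
    have h1 := LinearMap.finrank_range_add_finrank_ker T
    rw [hT, Fintype.range_linearCombination] at h1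
    have h2 : finrank ℚ (Submodule.span ℚ (Set.range a)) = m := ha
    rw [h2] at h1
    simp only [finrank_fintype_fun_eq_card, Fintype.card_fin] at h1
    rw [hT]
    omega
  obtain ⟨⟨μ, hμ⟩, hμ0, hgen⟩ := finrank_eq_one_iff'.1 hker
  have hμ0' : μ ≠ 0 := fun h => hμ0 (Subtype.ext h)
  obtain ⟨l, hl⟩ := exists_isFirstNonzero μ hμ0'
  have habs : |μ l| ≠ 0 := abs_ne_zero.2 hl.1
  -- a relation whose first non-zero coefficient has absolute value 1
  set ν : Fin (m + 1) → ℚ := |μ l|⁻¹ • μ with hν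
  have hνl : IsFirstNonzero ν l := hl.smul (inv_ne_zero habs)
  have hνabs : |ν l| = 1 := by
    simp [hν, abs_mul, abs_inv, habs]
  have hν0 : ν ≠ 0 := fun h => hνl.1 (by rw [h]; rfl)
  have hνrel : ∑ j, ν j • a j = 0 := by
    have : T ν = 0 := by rw [hν, map_smul, LinearMap.mem_ker.1 hμ, smul_zero]
    simpa [hT, Fintype.linearCombination_apply] using this
  have hall : ∀ c : Fin (m + 1) → ℚ, ∑ j, c j • a j = 0 → ∃ q : ℚ, c = q • ν := by
    intro c hc
    obtain ⟨q, hq⟩ := hgen ⟨c, by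
      rw [LinearMap.mem_ker, hT, Fintype.linearCombination_apply]; exact hc⟩
    refine ⟨q * |μ l|, ?_⟩
    have h1 : q • μ = c := congrArg Subtype.val hq
    rw [hν, smul_smul, mul_assoc, mul_inv_cancel₀ habs, mul_one, h1]
  have key : ∃ c, (c = ν ∨ c = -ν) ∧ numNeg c ≤ numPos c ∧ (numNeg c = numPos c → c l < 0) := by
    rcases lt_trichotomy (numNeg ν) (numPos ν) with h | h | h
    · exact ⟨ν, Or.inl rfl, h.le, fun h' => absurd h' h.ne⟩
    · rcases lt_or_gt_of_ne hνl.1 with h' | h'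
      · exact ⟨ν, Or.inl rfl, h.le, fun _ => h'⟩
      · refine ⟨-ν, Or.inr rfl, ?_, fun _ => by simpa using h'⟩
        rw [numNeg_neg, numPos_neg, h]
    · refine ⟨-ν, Or.inr rfl, ?_, fun h' => ?_⟩
      · rw [numNeg_neg, numPos_neg]
        exact h.le
      · rw [numNeg_neg, numPos_neg] at h'
        exact absurd h' h.ne
  obtain ⟨c, hcν, hle, hfirst⟩ := key
  have hcl : IsFirstNonzero c l := by
    rcases hcν with rfl | rfl
    · exact hνl
    · simpa using hνl.smul (q := -1) (by norm_num)
  have hcabs : |c l| = 1 := by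
    rcases hcν with rfl | rfl <;> simpa using hνabs
  have hcrel : ∑ j, c j • a j = 0 := by
    rcases hcν with rfl | rfl
    · exact hνrel
    · simp [hνrel]
  have hc0 : c ≠ 0 := fun h => hcl.1 (by rw [h]; rfl)
  refine ⟨c, ⟨hcrel, hc0, hle, fun h l' hl' => ?_, fun l' hl' => ?_⟩, ?_⟩
  · rw [hl'.unique hcl]
    exact hfirst h
  · rw [hl'.unique hcl]
    exact hcabs
  · intro c' hc'
    have hq : c' = c ∨ c' = -c := by
      obtain ⟨q, hq⟩ := hall c' hc'.relation
      have hq0 : q ≠ 0 := by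
        rintro rfl
        exact hc'.ne_zero (by simpa using hq)
      have hq1 : |q| = 1 := by
        have h1 := hc'.first_abs l (hq ▸ hνl.smul hq0)
        rw [hq, Pi.smul_apply, smul_eq_mul, abs_mul, hνabs, mul_one] at h1
        exact h1
      rcases eq_or_eq_neg_of_abs_eq hq1 with rfl | rfl <;> rcases hcν with rfl | rfl <;>
        simp [hq]
    rcases hq with h | h
    · exact h
    · exfalso
      have h1 := hc'.numNeg_le
      rw [h, numNeg_neg, numPos_neg] at h1
      have heq : numNeg c = numPos c := le_antisymm hle h1
      have h2 := hfirst heq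
      have hfl : IsFirstNonzero c' l := by
        rw [h]
        simpa using hcl.smul (q := -1) (by norm_num)
      have h3 := hc'.first_neg (by rw [h, numNeg_neg, numPos_neg, heq]) l hfl
      rw [h, Pi.neg_apply] at h3
      linarith

open Classical in
/-- The coefficients of the standard non-trivial relation among `a_0, …, a_m`, for a family of rank
`m` (and `0`, a value of no significance, for a family of another rank). -/
noncomputable def standardRelation {m : ℕ} (a : Fin (m + 1) → W) : Fin (m + 1) → ℚ :=
  if ha : rank a = m then (existsUnique_standardRelation a ha).choose else 0

/-- The number `k⁻(a_0, …, a_m)` of negative coefficients in the standard relation. -/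
noncomputable def kMinus {m : ℕ} (a : Fin (m + 1) → W) : ℕ := numNeg (standardRelation a)

end Relation

end GeomBernoulli

/-!
The function `B_a(v)` is, up to `sign det a`, the constant term in `t` of `e^{wt}` times the
generating function `∑ e^{x(δ)t}` of the points `δ ∈ v + L` of the closed simplicial cone
`{a_j ≥ 0 for all j}`: it is tiled by the translates of the half-open parallelepiped containing
`F(a, v)` under the non-negative integral combinations of the dual family `α`, so its generating
function is `∑_{δ ∈ F(a, v)} e^{x(δ)t} / ∏ (1 - e^{x(α_j)t})` (`geometricBernoulli_eq`,
`simplicialSum_mem_regularizedSums`). The alternating sum of the `B`'s is therefore governed by a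
relation between indicator functions of cones.

The generating functions are treated algebraically (`regularizedSums`): the group ring `ℤ[V]` acts
on functions on `V` by translation, and a function has a regularized sum when some element of the
group ring, not killed by the exponential character, makes it finitely supported. Such a sum is
unique (`regularizedSums_unique`), additive, and it is `0` for a function with a non-zero period, in
particular for a cone defined by fewer than `n` half-spaces
(`coneIndicator_regularizedSum_of_card_lt`). All sums are multiplied by `t^n`, which keeps them in
the ring of power series.

Let `∑ c_j a_j = 0` be a relation and let `Q` be the set of `j` with `c_j > 0`, assumed non-empty.
No point satisfies `a_j < 0` for `j ∈ Q` and `a_j ≥ 0` for `j ∉ Q`. Expanding the indicator function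
of these inequalities by inclusion-exclusion and discarding the cones with fewer than `n` facets
shows that the cone `{a_j ≥ 0 for all j}` has the regularized sum
`∑_{j ∈ Q} S_j`, where `S_j` is that of the cone with the `j`-th inequality dropped
(`coneIndicator_univ_regularizedSum`). The same holds for `-c` if `c` has negative coefficients, and
the two expressions cancel. By Cramer's rule (`sum_det_smul_eq_zero`) the numbers
`(-1)^j det(a_0, …, â_j, …, a_n)` are a common multiple of the `c_j`, so their signs are those with
which the cones occur in the alternating sum (`sum_geometricBernoulli_eq`). If no coefficient is
negative and the forms are in general position, the cone `{a_j ≥ 0 for all j}` is the origin, which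
contributes `1` if `v = 0` and `0` otherwise (`coneIndicator_univ_of_pos`).
-/

namespace GeomBernoulli

/-! ### Regularized sums of functions on an abelian group -/

section RegularizedSums

variable {V : Type*} [AddCommGroup V]

/-- The action of the group ring `ℤ[V]` on the functions on `V` by translations: `[u]` sends `f` to
`δ ↦ f (δ - u)`. -/
noncomputable def translation (V : Type*) [AddCommGroup V] :
    AddMonoidAlgebra ℤ V →ₐ[ℤ] Module.End ℤ (V → ℤ) :=
  AddMonoidAlgebra.lift ℤ _ V
    { toFun := fun u => LinearMap.funLeft ℤ ℤ fun δ => δ - u.toAdd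
      map_one' := by ext; simp [LinearMap.funLeft_apply]
      map_mul' := by
        intro u u'
        refine LinearMap.ext fun f => funext fun δ => ?_
        simp [LinearMap.funLeft_apply, sub_sub] }

theorem translation_single (u : V) (k : ℤ) (f : V → ℤ) (δ : V) :
    translation V (AddMonoidAlgebra.single u k) f δ = k * f (δ - u) := by
  simp [translation, LinearMap.funLeft_apply]

open Classical in
theorem translation_delta (p : AddMonoidAlgebra ℤ V) (δ : V) :
    translation V p (Pi.single 0 1) δ = p.coeff δ := by
  induction p using AddMonoidAlgebra.induction_linear with
  | zero => simp
  | add p q hp hq => simp [hp, hq]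
  | single u k =>
    simp [translation_single, Pi.single_apply, sub_eq_zero, Finsupp.single_apply, eq_comm]

theorem translation_one_sub_single (u : V) (f : V → ℤ) (δ : V) :
    translation V (1 - AddMonoidAlgebra.single u 1) f δ = f δ - f (δ - u) := by
  simp [translation_single]

variable {A : Type*} [CommRing A]

open Classical in
/-- The regularized sums of functions on `V` for a character `E` of `V`, multiplied by a fixed
constant `c`: the pairs `(f, S)` such that some `p` in `ℤ[V]` with `E(p) ≠ 0` turns `f` into a
finitely supported function `g` with `E(p) S = c E(g)`. Informally, `S = c ∑ f(δ) E(δ)`. -/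
noncomputable def regularizedSums [IsDomain A] (E : Multiplicative V →* A) (c : A) :
    AddSubgroup ((V → ℤ) × A) where
  carrier := {F | ∃ p g : AddMonoidAlgebra ℤ V, AddMonoidAlgebra.lift ℤ A V E p ≠ 0 ∧
    translation V p F.1 = translation V g (Pi.single 0 1) ∧
    AddMonoidAlgebra.lift ℤ A V E p * F.2 = c * AddMonoidAlgebra.lift ℤ A V E g}
  zero_mem' := ⟨1, 0, by simp, by simp, by simp⟩
  add_mem' := by
    rintro F F' ⟨p, g, hp, h, hS⟩ ⟨p', g', hp', h', hS'⟩
    refine ⟨p * p', p' * g + p * g', by simp [hp, hp'], ?_, ?_⟩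
    · simp only [Prod.fst_add, map_add, map_mul, LinearMap.add_apply, Module.End.mul_apply, ← h,
        ← h']
      simp only [← Module.End.mul_apply, ← map_mul, mul_comm p p']
    · simp only [Prod.snd_add, map_add, map_mul]
      linear_combination (AddMonoidAlgebra.lift ℤ A V E p') * hS +
        (AddMonoidAlgebra.lift ℤ A V E p) * hS'
  neg_mem' := by
    rintro F ⟨p, g, hp, h, hS⟩
    exact ⟨p, -g, hp, by simp [h], by simp [hS]⟩

variable [IsDomain A] {E : Multiplicative V →* A} {c : A}

theorem regularizedSums_unique {f : V → ℤ} {S S' : A} (h : (f, S) ∈ regularizedSums E c)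
    (h' : (f, S') ∈ regularizedSums E c) : S = S' := by
  classical
  obtain ⟨p, g, hp, h, hS⟩ := h
  obtain ⟨p', g', hp', h', hS'⟩ := h'
  have hg : p' * g = p * g' := by
    apply AddMonoidAlgebra.coeff_injective
    ext δ
    rw [← translation_delta, ← translation_delta, map_mul, map_mul, Module.End.mul_apply,
      Module.End.mul_apply, ← h, ← h', ← Module.End.mul_apply, ← Module.End.mul_apply, ← map_mul,
      ← map_mul, mul_comm]
  have hEg := congrArg (AddMonoidAlgebra.lift ℤ A V E) hg
  simp only [map_mul] at hEg hS hS'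
  refine mul_left_cancel₀ (mul_ne_zero hp hp') ?_
  linear_combination (AddMonoidAlgebra.lift ℤ A V E p') * hS -
        (AddMonoidAlgebra.lift ℤ A V E p) * hS' + c * hEg

/-- A function with a period `u` such that `E(u) ≠ 1` has regularized sum `0`. -/
theorem regularizedSums_of_periodic {f : V → ℤ} {u : V} (hu : E (.ofAdd u) ≠ 1)
    (hf : ∀ δ, f (δ - u) = f δ) : (f, 0) ∈ regularizedSums E c := by
  refine ⟨1 - AddMonoidAlgebra.single u 1, 0, ?_, ?_, by simp⟩
  · simpa [sub_eq_zero] using hu.symm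
  · ext δ
    simp [translation_single, hf]

end RegularizedSums
/-! ### Indicator functions of polyhedral cones in a coset of the lattice -/

section Cones

variable {n : ℕ} {V : Type*} [AddCommGroup V] [Module ℚ V] {ι : Type*}

open Classical in
/-- The indicator function of the points `δ` of the coset `v` of the lattice such that
`0 ≤ a_i(δ)` for all `i` in `s`. -/
noncomputable def coneIndicator (B : Basis (Fin n) ℚ V) (a : ι → Dual ℚ V)
    (v : V ⧸ lattice B) (s : Finset ι) : V → ℤ :=
  fun δ => if (lattice B).mkQ δ = v then ∏ i ∈ s, if 0 ≤ a i δ then 1 else 0 else 0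

omit [Module ℚ V] in
theorem mkQ_sub_of_mem {L : Submodule ℤ V} {u : V} (hu : u ∈ L) (δ : V) :
    L.mkQ (δ - u) = L.mkQ δ := by
  rw [map_sub, show L.mkQ u = 0 from (Submodule.Quotient.mk_eq_zero L).2 hu, sub_zero]

theorem finrank_eq_of_basis (B : Basis (Fin n) ℚ V) : finrank ℚ V = n := by
  simpa using finrank_eq_card_basis B

/-- Fewer than `n` linear forms on `V` vanish simultaneously on a non-zero lattice vector. -/
theorem exists_lattice_vector_of_card_lt (B : Basis (Fin n) ℚ V) (a : ι → Dual ℚ V)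
    {s : Finset ι} (hs : s.card < n) :
    ∃ u ∈ lattice B, u ≠ 0 ∧ ∀ i ∈ s, a i u = 0 := by
  have : FiniteDimensional ℚ V := B.finiteDimensional_of_finite
  have hker := LinearMap.ker_ne_bot_of_finrank_lt (f := LinearMap.pi fun i : s => a i)
    (by simpa [finrank_eq_of_basis B] using hs)
  obtain ⟨x, hx, hx0⟩ := Submodule.exists_mem_ne_zero_of_ne_bot hker
  obtain ⟨q, hq, hprim⟩ := exists_primitive_smul B x hx0
  refine ⟨q • x, hprim.1, smul_ne_zero hq.ne' hx0, fun i hi => ?_⟩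
  have : a i x = 0 := congrFun (LinearMap.mem_ker.1 hx) ⟨i, hi⟩
  simp [this]

variable {A : Type*} [CommRing A] [IsDomain A] {E : Multiplicative V →* A} {c : A}

/-- A cone cut out by fewer than `n` half-spaces contains a line, so its regularized sum is `0`. -/
theorem coneIndicator_regularizedSum_of_card_lt (hE : ∀ u : V, u ≠ 0 → E (.ofAdd u) ≠ 1)
    (B : Basis (Fin n) ℚ V) (a : ι → Dual ℚ V) (v : V ⧸ lattice B) {s : Finset ι}
    (hs : s.card < n) : (coneIndicator B a v s, 0) ∈ regularizedSums E c := by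
  classical
  obtain ⟨u, hu, hu0, hau⟩ := exists_lattice_vector_of_card_lt B a hs
  refine regularizedSums_of_periodic (hE u hu0) fun δ => ?_
  have hprod : (∏ i ∈ s, if 0 ≤ a i (δ - u) then 1 else 0 : ℤ) =
      ∏ i ∈ s, if 0 ≤ a i δ then 1 else 0 :=
    Finset.prod_congr rfl fun i hi => by rw [map_sub, hau i hi, sub_zero]
  rw [coneIndicator, coneIndicator, hprod]
  exact if_congr (by rw [mkQ_sub_of_mem hu]) rfl rfl

/-- If no point satisfies `a_i < 0` for `i` in `Q` and `0 ≤ a_i` for `i` outside `Q`, the expansion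
of the indicator function of these inequalities is an alternating sum of cones that vanishes. -/
theorem sum_powerset_coneIndicator [Fintype ι] [DecidableEq ι] (B : Basis (Fin n) ℚ V)
    (a : ι → Dual ℚ V) (v : V ⧸ lattice B) (Q : Finset ι)
    (hQ : ∀ δ, (∀ i ∈ Q, a i δ < 0) → ∃ i ∉ Q, a i δ < 0) :
    ∑ T ∈ Q.powerset, (-1 : ℤ) ^ T.card • coneIndicator B a v Tᶜ = 0 := by
  classical
  funext δ
  by_cases hv : (lattice B).mkQ δ = v
  swap
  · simp only [coneIndicator, if_neg hv, Finset.sum_apply, Pi.smul_apply, smul_zero,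
      Finset.sum_const_zero, Pi.zero_apply]
  set h : ι → ℤ := fun i => if 0 ≤ a i δ then 1 else 0 with hh
  have hprod : (∏ i ∈ Q, (-1 + h i)) * ∏ i ∈ Qᶜ, h i = 0 := by
    by_cases hneg : ∀ i ∈ Q, a i δ < 0
    · obtain ⟨i, hi, hlt⟩ := hQ δ hneg
      rw [Finset.prod_eq_zero (Finset.mem_compl.2 hi) (by simp [hh, hlt]), mul_zero]
    · push Not at hneg
      obtain ⟨i, hi, hle⟩ := hneg
      rw [Finset.prod_eq_zero hi (by simp [hh, hle]), zero_mul]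
  rw [Finset.prod_add, Finset.sum_mul] at hprod
  simp only [Finset.sum_apply, Pi.smul_apply, Pi.zero_apply, smul_eq_mul]
  rw [← hprod]
  refine Finset.sum_congr rfl fun T hT => ?_
  rw [Finset.prod_const, mul_assoc, coneIndicator, if_pos hv, ← Finset.prod_union]
  · congr 2
    ext i
    have : i ∈ T → i ∈ Q := fun h => Finset.mem_powerset.1 hT h
    simp only [Finset.mem_compl, Finset.mem_union, Finset.mem_sdiff]
    tauto
  · exact Finset.disjoint_left.2 fun i hi hi' =>
      Finset.mem_compl.1 hi' (Finset.mem_sdiff.1 hi).1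

/-- Modulo cones that contain a line, the cone cut out by all the half-spaces is the sum over `j` in
`Q` of the cones obtained by dropping the `j`-th one. -/
theorem coneIndicator_univ_sub_sum (hE : ∀ u : V, u ≠ 0 → E (.ofAdd u) ≠ 1)
    (B : Basis (Fin n) ℚ V) (a : Fin (n + 1) → Dual ℚ V) (v : V ⧸ lattice B)
    (Q : Finset (Fin (n + 1))) (hQ : ∀ δ, (∀ i ∈ Q, a i δ < 0) → ∃ i ∉ Q, a i δ < 0) :
    (coneIndicator B a v Finset.univ - ∑ j ∈ Q, coneIndicator B a v {j}ᶜ, 0) ∈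
      regularizedSums E c := by
  have hsum := sum_powerset_coneIndicator B a v Q hQ
  rw [← Finset.sum_filter_add_sum_filter_not _ fun T => 2 ≤ T.card] at hsum
  have hsmall : Q.powerset.filter (fun T => ¬2 ≤ T.card) = insert ∅ (Q.image singleton) := by
    ext T
    simp only [Finset.mem_filter, Finset.mem_powerset, Finset.mem_insert, Finset.mem_image]
    constructor
    · rintro ⟨hTQ, hT⟩
      rcases Finset.card_le_one_iff_subset_singleton.1 (by omega : T.card ≤ 1) with ⟨j, hj⟩
      rcases Finset.subset_singleton_iff.1 hj with rfl | rfl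
      · exact Or.inl rfl
      · exact Or.inr ⟨j, hTQ (Finset.mem_singleton_self j), rfl⟩
    · rintro (rfl | ⟨j, hj, rfl⟩)
      · simp
      · simpa using hj
  rw [hsmall, Finset.sum_insert (by simp), Finset.sum_image (by simp)] at hsum
  simp only [Finset.card_empty, pow_zero, one_smul, Finset.compl_empty, Finset.card_singleton,
    pow_one, neg_smul, Finset.sum_neg_distrib, ← sub_eq_add_neg] at hsum
  -- only the terms where at least two half-spaces are dropped remain
  have hlines : ((coneIndicator B a v Finset.univ - ∑ j ∈ Q, coneIndicator B a v {j}ᶜ, 0) :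
      (V → ℤ) × A) = -∑ T ∈ Q.powerset with 2 ≤ T.card,
        (-1 : ℤ) ^ T.card • (coneIndicator B a v Tᶜ, (0 : A)) := by
    ext1
    · simpa [Prod.fst_sum] using eq_neg_of_add_eq_zero_right hsum
    · simp [Prod.snd_sum]
  rw [hlines]
  refine neg_mem (sum_mem fun T hT => zsmul_mem
    (coneIndicator_regularizedSum_of_card_lt hE B a v ?_) _)
  have h1 := (Finset.mem_filter.1 hT).2
  have h2 := Finset.card_le_univ T
  rw [Finset.card_compl, Fintype.card_fin]
  rw [Fintype.card_fin] at h2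
  omega

/-- The cone cut out by `n` linearly independent forms is simplicial: multiplying its indicator
function by `∏ (1 - [α_j])`, where `α` is the dual family, leaves the half-open parallelepiped. -/
theorem translation_prod_coneIndicator (B : Basis (Fin n) ℚ V) (a : Fin n → Dual ℚ V)
    {α : Fin n → V} (hα : IsPrimitivePositiveDual B a α) (v : V ⧸ lattice B) (s : Finset (Fin n))
    (δ : V) [Decidable ((lattice B).mkQ δ = v ∧ (∀ j, 0 ≤ a j δ) ∧ ∀ j ∈ s, a j δ < a j (α j))] :
    translation V (∏ j ∈ s, (1 - AddMonoidAlgebra.single (α j) 1))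
      (coneIndicator B a v Finset.univ) δ =
      if (lattice B).mkQ δ = v ∧ (∀ j, 0 ≤ a j δ) ∧ ∀ j ∈ s, a j δ < a j (α j) then 1 else 0 := by
  classical
  induction s using Finset.induction_on generalizing δ with
  | empty =>
    rw [Finset.prod_empty, map_one, Module.End.one_apply, coneIndicator, Finset.prod_boole]
    simp only [Finset.mem_univ, true_implies, Finset.notMem_empty, false_implies, implies_true,
      and_true, ite_and]
  | insert k s hk ih =>
    rw [Finset.prod_insert hk, map_mul, Module.End.mul_apply, translation_one_sub_single, ih, ih,
      mkQ_sub_of_mem (hα k).1.1]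
    obtain ⟨-, hpos, hzero⟩ := hα k
    -- subtracting `α_k` only changes the value of the `k`-th form
    have hother : ∀ j, j ≠ k → a j (δ - α k) = a j δ := fun j hj => by
      rw [map_sub, hzero j hj, sub_zero]
    have hs : (∀ j ∈ s, a j (δ - α k) < a j (α j)) ↔ ∀ j ∈ s, a j δ < a j (α j) :=
      forall₂_congr fun j hj => by rw [hother j (ne_of_mem_of_not_mem hj hk)]
    have hnonneg : (∀ j, 0 ≤ a j (δ - α k)) ↔ (∀ j, 0 ≤ a j δ) ∧ a k (α k) ≤ a k δ := by
      constructor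
      · intro h
        have hk' := h k
        rw [map_sub, sub_nonneg] at hk'
        refine ⟨fun j => ?_, hk'⟩
        by_cases hj : j = k
        · exact hj ▸ hpos.le.trans hk'
        · exact hother j hj ▸ h j
      · rintro ⟨h, hk'⟩ j
        by_cases hj : j = k
        · subst hj
          rwa [map_sub, sub_nonneg]
        · exact (hother j hj).symm ▸ h j
    simp only [hs, hnonneg, Finset.forall_mem_insert]
    by_cases h1 : (lattice B).mkQ δ = v <;> by_cases h2 : ∀ j, 0 ≤ a j δ <;>
      by_cases h3 : ∀ j ∈ s, a j δ < a j (α j) <;> by_cases h4 : a k (α k) ≤ a k δ <;>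
      simp [h1, h2, h3, h4, not_lt.2, not_le.1]

/-- The regularized sum of a simplicial cone is `c ∑_{δ ∈ F(a, v)} E(δ) / ∏ (1 - E(α_j))`. -/
theorem coneIndicator_regularizedSum_of_linearIndependent
    (hE : ∀ u : V, u ≠ 0 → E (.ofAdd u) ≠ 1) (B : Basis (Fin n) ℚ V) (a : Fin n → Dual ℚ V)
    {α : Fin n → V} (hα : IsPrimitivePositiveDual B a α) (v : V ⧸ lattice B)
    {F : Finset V} (hF : ∀ δ, δ ∈ F ↔ δ ∈ fundamentalSet B a α v) {S : A}
    (hS : (∏ j, (1 - E (.ofAdd (α j)))) * S = c * ∑ δ ∈ F, E (.ofAdd δ)) :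
    (coneIndicator B a v Finset.univ, S) ∈ regularizedSums E c := by
  classical
  refine ⟨∏ j, (1 - AddMonoidAlgebra.single (α j) 1), ∑ δ ∈ F, AddMonoidAlgebra.single δ 1,
    ?_, ?_, by simpa using hS⟩
  · rw [map_prod]
    refine Finset.prod_ne_zero_iff.2 fun j _ => ?_
    have hα0 : α j ≠ 0 := fun h => by simpa [h] using (hα j).2.1
    simpa [sub_eq_zero] using (hE _ hα0).symm
  · funext δ
    rw [translation_prod_coneIndicator B a hα, map_sum, LinearMap.sum_apply, Finset.sum_apply]
    simp only [translation_single, Pi.single_apply, sub_eq_zero, one_mul, Finset.sum_ite_eq, hF,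
      fundamentalSet, Set.mem_ofPred_eq, Finset.mem_univ, true_implies, forall_and]

theorem coneIndicator_compl_singleton (B : Basis (Fin n) ℚ V) (a : Fin (n + 1) → Dual ℚ V)
    (v : V ⧸ lattice B) (j : Fin (n + 1)) :
    coneIndicator B a v {j}ᶜ = coneIndicator B (fun i => a (j.succAbove i)) v Finset.univ := by
  funext δ
  rw [coneIndicator, coneIndicator, ← Fin.image_succAbove_univ,
    Finset.prod_image (Fin.succAbove_right_injective.injOn)]

end Cones
/-! ### The exponential character and the geometric Bernoulli functions -/

section Exponential

variable {n : ℕ} {V : Type*} [AddCommGroup V] [Module ℚ V]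

theorem formalValue_add (B : Basis (Fin n) ℚ V) (δ δ' : V) :
    formalValue B (δ + δ') = formalValue B δ + formalValue B δ' := by
  simp [formalValue, add_mul, Finset.sum_add_distrib]

theorem formalValue_zero (B : Basis (Fin n) ℚ V) : formalValue B 0 = 0 := by
  simp [formalValue]

theorem formalValue_ne_zero (B : Basis (Fin n) ℚ V) {δ : V} (hδ : δ ≠ 0) :
    formalValue B δ ≠ 0 := by
  intro h
  refine hδ (B.repr.injective (Finsupp.ext fun i => ?_))
  have := congrArg (MvPolynomial.coeff (Finsupp.single i 1)) h
  simpa [formalValue, MvPolynomial.coeff_C_mul, MvPolynomial.coeff_X, Finsupp.single_left_inj,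
    MvPolynomial.coeff_sum] using this

/-- The value `x(δ)` of the indeterminate linear form, in the fraction field `ℚ(x)`. -/
noncomputable def fractionValue (B : Basis (Fin n) ℚ V) (δ : V) :
    FractionRing (MvPolynomial (Fin n) ℚ) :=
  algebraMap _ _ (formalValue B δ)

theorem fractionValue_ne_zero (B : Basis (Fin n) ℚ V) {δ : V} (hδ : δ ≠ 0) :
    fractionValue B δ ≠ 0 := by
  simpa [fractionValue] using formalValue_ne_zero B hδ

open PowerSeries in
/-- The character `δ ↦ e^{x(δ)t}` of `V`, with values in the power series in `t` over `ℚ[w](x)`. -/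
noncomputable def expCharacter (B : Basis (Fin n) ℚ V) :
    Multiplicative V →* PowerSeries (BernoulliFunctions n) where
  toFun u := rescale (Polynomial.C (fractionValue B u.toAdd)) (exp (BernoulliFunctions n))
  map_one' := by simp [fractionValue, formalValue_zero]
  map_mul' u u' := by
    rw [exp_mul_exp_eq_exp_add, ← Polynomial.C_add, toAdd_mul, fractionValue, formalValue_add,
      map_add, fractionValue, fractionValue]

theorem expCharacter_ofAdd (B : Basis (Fin n) ℚ V) (u : V) :
    expCharacter B (.ofAdd u) = PowerSeries.rescale (Polynomial.C (fractionValue B u))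
      (PowerSeries.exp (BernoulliFunctions n)) := rfl

theorem expCharacter_ne_one (B : Basis (Fin n) ℚ V) (u : V) (hu : u ≠ 0) :
    expCharacter B (.ofAdd u) ≠ 1 := by
  intro h
  have := congrArg (PowerSeries.coeff 1) h
  rw [expCharacter_ofAdd, PowerSeries.coeff_rescale] at this
  simp [PowerSeries.coeff_exp, PowerSeries.coeff_one, fractionValue_ne_zero B hu] at this

open Classical in
/-- The regularized sum of `e^{x(δ)t}` over the simplicial cone of a linearly independent family
`a` and the coset `v`, multiplied by `t^n` (and `0` for a linearly dependent family). -/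
noncomputable def simplicialSum (B : Basis (Fin n) ℚ V) (a : Fin n → Dual ℚ V)
    (v : V ⧸ lattice B) : PowerSeries (BernoulliFunctions n) :=
  if ha : LinearIndependent ℚ a then
    (∏ j, PowerSeries.C (-Polynomial.C (fractionValue B (primitivePositiveDual B a ha j))⁻¹) *
      PowerSeries.rescale (Polynomial.C (fractionValue B (primitivePositiveDual B a ha j)))
        (bernoulliPowerSeries (BernoulliFunctions n))) *
    ∑ δ ∈ (fundamentalSet_finite B a ha _ (primitivePositiveDual_spec B a ha) v).toFinset,
      expCharacter B (.ofAdd δ)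
  else 0

theorem simplicialSum_mem_regularizedSums (B : Basis (Fin n) ℚ V) {a : Fin n → Dual ℚ V}
    (ha : LinearIndependent ℚ a) (v : V ⧸ lattice B) :
    (coneIndicator B a v Finset.univ, simplicialSum B a v) ∈
      regularizedSums (expCharacter B) (PowerSeries.X ^ n) := by
  have hα := primitivePositiveDual_spec B a ha
  refine coneIndicator_regularizedSum_of_linearIndependent (expCharacter_ne_one B) B a hα v
    (fun δ => Set.Finite.mem_toFinset
      (fundamentalSet_finite B a ha _ hα v)) ?_
  rw [simplicialSum, dif_pos ha, ← mul_assoc, ← Finset.prod_mul_distrib]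
  congr 1
  rw [Finset.prod_congr rfl (g := fun _ => PowerSeries.X) fun j _ => ?_, Finset.prod_const,
    Finset.card_univ, Fintype.card_fin]
  have hα0 : primitivePositiveDual B a ha j ≠ 0 := fun h => by simpa [h] using (hα j).2.1
  set ω := fractionValue B (primitivePositiveDual B a ha j) with hω
  have hω0 : ω ≠ 0 := fractionValue_ne_zero B hα0
  have hb := congrArg (PowerSeries.rescale (Polynomial.C ω))
    (bernoulliPowerSeries_mul_exp_sub_one (A := BernoulliFunctions n))
  rw [map_mul, map_sub, map_one, PowerSeries.rescale_X] at hb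
  have hC : PowerSeries.C (-Polynomial.C ω⁻¹) * PowerSeries.C (Polynomial.C ω) =
      (-1 : PowerSeries (BernoulliFunctions n)) := by
    have h : (Polynomial.C ω⁻¹ * Polynomial.C ω : BernoulliFunctions n) = 1 := by
      rw [← map_mul, inv_mul_cancel₀ hω0, map_one]
    have h' : (-Polynomial.C ω⁻¹ * Polynomial.C ω : BernoulliFunctions n) = -1 := by
      linear_combination -h
    rw [← map_mul, h', map_neg, map_one]
  rw [expCharacter_ofAdd, ← hω]
  linear_combination -PowerSeries.C (-Polynomial.C ω⁻¹) * hb - PowerSeries.X * hC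

theorem map_multipleBernoulli {A A' : Type*} [CommRing A] [Algebra ℚ A] [CommRing A']
    [Algebra ℚ A'] (f : A →+* A') {n : ℕ} (m : ℕ) (z : A) (ω : Fin n → A) :
    f (multipleBernoulli m z ω) = multipleBernoulli m (f z) fun j => f (ω j) := by
  have hb : PowerSeries.map f (bernoulliPowerSeries A) = bernoulliPowerSeries A' := by
    ext k
    simp only [bernoulliPowerSeries, PowerSeries.coeff_map, PowerSeries.coeff_mk]
    exact congrFun (congrArg DFunLike.coe
      (Subsingleton.elim (f.comp (algebraMap ℚ A)) (algebraMap ℚ A'))) _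
  rw [multipleBernoulli, multipleBernoulli, map_mul, map_natCast, ← PowerSeries.coeff_map, map_mul,
    map_prod, ← PowerSeries.rescale_map, PowerSeries.map_exp]
  simp only [← PowerSeries.rescale_map, hb]

/-- `B_a(v)` is the sign of the determinant times the constant term in `t` of `e^{wt}` times the
regularized sum of `e^{x(δ)t}` over the simplicial cone of `a`. -/
theorem geometricBernoulli_eq (B : Basis (Fin n) ℚ V) (a : Fin n → Dual ℚ V)
    (v : V ⧸ lattice B) :
    geometricBernoulli B a v = (signDet B a : BernoulliFunctions n) * PowerSeries.coeff n
      (PowerSeries.rescale Polynomial.X (PowerSeries.exp (BernoulliFunctions n)) *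
        simplicialSum B a v) := by
  by_cases ha : LinearIndependent ℚ a
  swap
  · simp [geometricBernoulli, simplicialSum, ha]
  rw [geometricBernoulli, dif_pos ha, simplicialSum, dif_pos ha, geometricBernoulliPolynomial]
  set F := (fundamentalSet_finite B a ha _ (primitivePositiveDual_spec B a ha) v).toFinset
  set α := primitivePositiveDual B a ha
  set b : (Fin n → BernoulliFunctions n) → PowerSeries (BernoulliFunctions n) :=
    fun ω => ∏ j, PowerSeries.rescale (ω j) (bernoulliPowerSeries (BernoulliFunctions n)) with hb
  set ω : Fin n → BernoulliFunctions n := fun j => Polynomial.C (fractionValue B (α j)) with hω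
  have hterm : ∀ δ, Polynomial.mapRingHom (algebraMap (MvPolynomial (Fin n) ℚ) (FractionRing _))
      (multipleBernoulli n (Polynomial.X + Polynomial.C (formalValue B δ))
        fun j => Polynomial.C (formalValue B (α j))) =
      (n.factorial : BernoulliFunctions n) * PowerSeries.coeff n (PowerSeries.rescale Polynomial.X
        (PowerSeries.exp (BernoulliFunctions n)) * (b ω * expCharacter B (.ofAdd δ))) := by
    intro δ
    rw [map_multipleBernoulli, multipleBernoulli, expCharacter_ofAdd, mul_left_comm,
      PowerSeries.exp_mul_exp_eq_exp_add, mul_comm (b ω)]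
    simp [hb, hω, fractionValue]
  have hprod : ∏ j, PowerSeries.C (-Polynomial.C (fractionValue B (α j))⁻¹) *
      PowerSeries.rescale (Polynomial.C (fractionValue B (α j)))
        (bernoulliPowerSeries (BernoulliFunctions n)) =
      PowerSeries.C ((-1) ^ n * Polynomial.C (∏ j, fractionValue B (α j))⁻¹) * b ω := by
    rw [Finset.prod_mul_distrib, ← map_prod, Finset.prod_congr rfl fun j _ =>
      neg_eq_neg_one_mul (Polynomial.C (fractionValue B (α j))⁻¹), Finset.prod_mul_distrib,
      Finset.prod_const, ← map_prod, Finset.prod_inv_distrib, Finset.card_univ, Fintype.card_fin]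
  have hscalar : algebraMap ℚ (BernoulliFunctions n)
      ((((-1) ^ n * signDet B a : ℤ) : ℚ) / (n.factorial : ℚ)) * n.factorial =
      (-1) ^ n * (signDet B a : BernoulliFunctions n) := by
    rw [← map_natCast (algebraMap ℚ (BernoulliFunctions n)), ← map_mul, div_mul_cancel₀ _
      (by exact_mod_cast n.factorial_ne_zero), map_intCast]
    push_cast
    rfl
  have hsmul : ∀ (q : ℚ) (P : BernoulliPolynomials n),
      Polynomial.mapRingHom (algebraMap (MvPolynomial (Fin n) ℚ) (FractionRing _)) (q • P) =
      algebraMap ℚ (BernoulliFunctions n) q * Polynomial.mapRingHom (algebraMap _ _) P := by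
    intro q P
    rw [Algebra.smul_def, map_mul]
    congr 1
    exact congrFun (congrArg DFunLike.coe (Subsingleton.elim
      ((Polynomial.mapRingHom (algebraMap _ _)).comp (algebraMap ℚ (BernoulliPolynomials n)))
      (algebraMap ℚ (BernoulliFunctions n)))) q
  rw [hprod, ← Polynomial.coe_mapRingHom, hsmul, map_sum, Finset.sum_congr rfl
    fun δ _ => hterm δ, ← Finset.mul_sum, ← mul_assoc (algebraMap _ _ _), hscalar,
    ← map_sum, ← Finset.mul_sum, ← Finset.mul_sum, mul_assoc (PowerSeries.C _), mul_left_comm,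
    mul_left_comm _ (PowerSeries.C _), PowerSeries.coeff_C_mul]
  simp only [fractionValue]
  ring

end Exponential
/-! ### Relations among `n + 1` linear forms -/

section Relations

variable {n : ℕ} {V : Type*} [AddCommGroup V] [Module ℚ V]

/-- Cramer's relation: the maximal minors of `n + 1` forms in dimension `n`, with alternating signs,
are the coefficients of a linear relation. -/
theorem sum_det_smul_eq_zero {W : Type*} [AddCommGroup W] [Module ℚ W] (b : Basis (Fin n) ℚ W)
    (a : Fin (n + 1) → W) :
    ∑ j : Fin (n + 1), ((-1) ^ (j : ℕ) * b.det (fun i => a (j.succAbove i))) • a j = 0 := by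
  apply b.ext_elem
  intro k
  -- the expansion along the first row of a determinant with two equal rows
  set M : Matrix (Fin (n + 1)) (Fin (n + 1)) ℚ :=
    Matrix.of (Fin.cons (fun j => b.repr (a j) k) fun i j => b.repr (a j) i) with hM
  have hdet : M.det = 0 :=
    Matrix.det_zero_of_row_eq (Fin.succ_ne_zero k).symm (by ext j; simp [hM])
  rw [Matrix.det_succ_row_zero] at hdet
  simp only [map_sum, map_smul, Finsupp.coe_finsetSum, Finset.sum_apply, Finsupp.smul_apply,
    smul_eq_mul, map_zero, Finsupp.zero_apply]
  rw [← hdet]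
  refine Finset.sum_congr rfl fun j _ => ?_
  have h0 : M 0 j = b.repr (a j) k := by simp [hM]
  have hsub : M.submatrix Fin.succ j.succAbove = b.toMatrix fun i => a (j.succAbove i) := by
    ext i l
    simp [hM, Basis.toMatrix_apply]
  rw [h0, hsub, Basis.det_apply]
  ring

theorem exists_eq_smul_of_rank_eq {W : Type*} [AddCommGroup W] [Module ℚ W] {m : ℕ}
    {a : Fin (m + 1) → W} (ha : rank a = m) {c μ : Fin (m + 1) → ℚ} (hc0 : c ≠ 0)
    (hc : ∑ j, c j • a j = 0) (hμ : ∑ j, μ j • a j = 0) : ∃ q : ℚ, μ = q • c := by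
  have hker : finrank ℚ (LinearMap.ker (Fintype.linearCombination ℚ a)) = 1 := by
    have h1 := LinearMap.finrank_range_add_finrank_ker (Fintype.linearCombination ℚ a)
    rw [Fintype.range_linearCombination, show finrank ℚ (Submodule.span ℚ (Set.range a)) = m from ha]
      at h1
    simp only [finrank_fintype_fun_eq_card, Fintype.card_fin] at h1
    omega
  have hmem : ∀ ν : Fin (m + 1) → ℚ, ∑ j, ν j • a j = 0 →
      ν ∈ LinearMap.ker (Fintype.linearCombination ℚ a) := fun ν hν => by
    rwa [LinearMap.mem_ker, Fintype.linearCombination_apply]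
  obtain ⟨q, hq⟩ := exists_smul_eq_of_finrank_eq_one hker (x := ⟨c, hmem c hc⟩)
    (fun h => hc0 (congrArg Subtype.val h)) ⟨μ, hmem μ hμ⟩
  exact ⟨q, (congrArg Subtype.val hq).symm⟩

theorem le_rank_of_linearIndependent (B : Basis (Fin n) ℚ V) (a : Fin (n + 1) → Dual ℚ V)
    (j : Fin (n + 1)) (h : LinearIndependent ℚ fun i => a (j.succAbove i)) : n ≤ rank a := by
  have : FiniteDimensional ℚ V := B.finiteDimensional_of_finite
  have h1 := finrank_span_eq_card h
  rw [Fintype.card_fin] at h1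
  exact h1.symm.le.trans (Submodule.finrank_mono
    (Submodule.span_mono (Set.range_comp_subset_range j.succAbove a)))

theorem det_ne_zero_iff_linearIndependent (B : Basis (Fin n) ℚ V) (a : Fin n → Dual ℚ V) :
    B.dualBasis.det a ≠ 0 ↔ LinearIndependent ℚ a := by
  have : FiniteDimensional ℚ V := B.finiteDimensional_of_finite
  rw [← isUnit_iff_ne_zero, ← Basis.is_basis_iff_det]
  refine ⟨fun h => h.1, fun h => ⟨h, h.span_eq_top_of_card_eq_finrank' ?_⟩⟩
  simp [Subspace.dual_finrank_eq, finrank_eq_of_basis B]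

theorem InGeneralPosition.linearIndependent_succAbove (B : Basis (Fin n) ℚ V)
    {a : Fin (n + 1) → Dual ℚ V} (ha : InGeneralPosition a) (j : Fin (n + 1)) :
    LinearIndependent ℚ fun i => a (j.succAbove i) := by
  have h := ha {j}ᶜ (by simp [Subspace.dual_finrank_eq, finrank_eq_of_basis B, Finset.card_compl])
  exact h.comp (fun i => ⟨j.succAbove i, by simp⟩) fun i i' hii' =>
    Fin.succAbove_right_injective (congrArg Subtype.val hii')

theorem standardRelation_spec {W : Type*} [AddCommGroup W] [Module ℚ W] {m : ℕ}
    {a : Fin (m + 1) → W} (ha : rank a = m) : IsStandardRelation a (standardRelation a) := by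
  rw [standardRelation, dif_pos ha]
  exact (existsUnique_standardRelation a ha).choose_spec.1

theorem numNeg_pos_iff {m : ℕ} {c : Fin (m + 1) → ℚ} : 0 < numNeg c ↔ ∃ j, c j < 0 := by
  simp [numNeg, Finset.card_pos, Finset.filter_nonempty_iff]

theorem numPos_pos_iff {m : ℕ} {c : Fin (m + 1) → ℚ} : 0 < numPos c ↔ ∃ j, 0 < c j := by
  simp [numPos, Finset.card_pos, Finset.filter_nonempty_iff]

/-- Given a relation with some positive coefficient, the forms with positive coefficient are not
all negative at a point where the other forms are non-negative. -/
theorem exists_neg_of_relation {m : ℕ} {a : Fin (m + 1) → Dual ℚ V} {c : Fin (m + 1) → ℚ}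
    (hc : ∑ j, c j • a j = 0) (hpos : ∃ j, 0 < c j) (δ : V)
    (hδ : ∀ i ∈ Finset.univ.filter (fun j => 0 < c j), a i δ < 0) :
    ∃ i ∉ Finset.univ.filter (fun j => 0 < c j), a i δ < 0 := by
  by_contra! h
  have hsum : ∑ j, c j * a j δ = 0 := by
    simpa using congrArg (fun f : Dual ℚ V => f δ) hc
  obtain ⟨j, hj⟩ := hpos
  refine hsum.not_lt (Finset.sum_neg' (fun i _ => ?_) ⟨j, Finset.mem_univ j, ?_⟩)
  · by_cases hi : 0 < c i
    · exact (mul_neg_of_pos_of_neg hi (hδ i (by simpa using hi))).le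
    · exact mul_nonpos_of_nonpos_of_nonneg (not_lt.1 hi) (h i (by simpa using hi))
  · exact mul_neg_of_pos_of_neg hj (hδ j (by simpa using hj))

/-- The cone cut out by all `n + 1` half-spaces and the simplicial cones that correspond to the
positive coefficients of a relation have the same total regularized sum. -/
theorem coneIndicator_univ_regularizedSum (B : Basis (Fin n) ℚ V) {a : Fin (n + 1) → Dual ℚ V}
    (v : V ⧸ lattice B) {c : Fin (n + 1) → ℚ} (hc : ∑ j, c j • a j = 0) (hpos : ∃ j, 0 < c j)
    (hind : ∀ j, 0 < c j → LinearIndependent ℚ fun i => a (j.succAbove i)) :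
    (coneIndicator B a v Finset.univ,
      ∑ j with 0 < c j, simplicialSum B (fun i => a (j.succAbove i)) v) ∈
      regularizedSums (expCharacter B) (PowerSeries.X ^ n) := by
  have h1 := coneIndicator_univ_sub_sum (c := PowerSeries.X ^ n) (expCharacter_ne_one B) B a v _
    (exists_neg_of_relation hc hpos)
  have h2 : ∑ j with 0 < c j, (coneIndicator B a v {j}ᶜ,
      simplicialSum B (fun i => a (j.succAbove i)) v) ∈
      regularizedSums (expCharacter B) (PowerSeries.X ^ n) := by
    refine sum_mem fun j hj => ?_
    rw [coneIndicator_compl_singleton]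
    exact simplicialSum_mem_regularizedSums B (hind j (Finset.mem_filter.1 hj).2) v
  convert add_mem h1 h2 using 1
  ext1
  · simp [Prod.fst_sum]
  · simp [Prod.snd_sum]

/-- The alternating sum of the `B_{a_0, …, â_j, …, a_n}(v)` is, up to the sign of the factor `q`
between Cramer's relation and `c`, the constant term of `e^{wt}` times the sum of the regularized
sums of the simplicial cones, weighted by the signs of the coefficients `c_j`. -/
theorem sum_geometricBernoulli_eq (B : Basis (Fin n) ℚ V) (a : Fin (n + 1) → Dual ℚ V)
    (v : V ⧸ lattice B) {c : Fin (n + 1) → ℚ} {q : ℚ}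
    (hq : ∀ j : Fin (n + 1),
      (-1) ^ (j : ℕ) * B.dualBasis.det (fun i => a (j.succAbove i)) = q * c j) :
    ∑ j : Fin (n + 1), (-1) ^ (j : ℕ) * geometricBernoulli B (fun i => a (j.succAbove i)) v =
      ((SignType.sign q : ℤ) : BernoulliFunctions n) * PowerSeries.coeff n
        (PowerSeries.rescale Polynomial.X (PowerSeries.exp (BernoulliFunctions n)) *
          (∑ j with 0 < c j, simplicialSum B (fun i => a (j.succAbove i)) v -
            ∑ j with 0 < -c j, simplicialSum B (fun i => a (j.succAbove i)) v)) := by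
  have hsign : ∀ j : Fin (n + 1), (-1) ^ (j : ℕ) * signDet B (fun i => a (j.succAbove i)) =
      (SignType.sign q : ℤ) * (SignType.sign (c j) : ℤ) := by
    intro j
    rw [← SignType.coe_mul, ← sign_mul, ← hq j, signDet]
    rcases neg_one_pow_eq_or ℤ (j : ℕ) with h | h
    · have h' : (-1 : ℚ) ^ (j : ℕ) = 1 := by exact_mod_cast h
      rw [h, h', one_mul, one_mul]
    · have h' : (-1 : ℚ) ^ (j : ℕ) = -1 := by exact_mod_cast h
      rw [h, h', neg_one_mul, neg_one_mul, Left.sign_neg, SignType.coe_neg]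
  rw [Finset.sum_filter, Finset.sum_filter, ← Finset.sum_sub_distrib, Finset.mul_sum, map_sum,
    Finset.mul_sum]
  refine Finset.sum_congr rfl fun j _ => ?_
  have hj : ((-1) ^ (j : ℕ) * (signDet B (fun i => a (j.succAbove i)) : BernoulliFunctions n)) =
      ((SignType.sign q : ℤ) : BernoulliFunctions n) * ((SignType.sign (c j) : ℤ) :) := by
    exact_mod_cast congrArg (Int.cast : ℤ → BernoulliFunctions n) (hsign j)
  rw [geometricBernoulli_eq, ← mul_assoc, hj, mul_assoc]
  congr 1
  rcases lt_trichotomy (c j) 0 with h | h | h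
  · rw [sign_neg h, if_neg h.not_gt, if_pos (neg_pos.2 h), mul_sub, map_sub]
    simp only [mul_zero, map_zero, SignType.coe_neg_one, Int.cast_neg, Int.cast_one]
    ring
  · simp [h]
  · simp [h, h.not_gt]

/-- Forms in general position that satisfy a relation with positive coefficients cut out the
origin alone. -/
theorem coneIndicator_univ_of_pos (B : Basis (Fin n) ℚ V) {a : Fin (n + 1) → Dual ℚ V}
    (v : V ⧸ lattice B) {c : Fin (n + 1) → ℚ} (hc : ∑ j, c j • a j = 0) (hpos : ∀ j, 0 < c j)
    (hind : LinearIndependent ℚ fun i : Fin n => a i.succ) [DecidableEq V] [Decidable (v = 0)] :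
    coneIndicator B a v Finset.univ = if v = 0 then Pi.single 0 1 else 0 := by
  classical
  funext δ
  by_cases hδ : δ = 0
  · subst hδ
    by_cases hv : v = 0
    · simp [coneIndicator, hv]
    · simp [coneIndicator, hv, Ne.symm hv]
  · have hneg : ∃ j, a j δ < 0 := by
      by_contra! h
      have hsum : ∑ j, c j * a j δ = 0 := by
        simpa using congrArg (fun f : Dual ℚ V => f δ) hc
      rw [Finset.sum_eq_zero_iff_of_nonneg fun j _ => mul_nonneg (hpos j).le (h j)] at hsum
      refine hδ ((pi_bijective B _ hind).1 (funext fun i => ?_))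
      simpa [(hpos i.succ).ne'] using hsum i.succ (Finset.mem_univ _)
    obtain ⟨j, hj⟩ := hneg
    rw [coneIndicator, Finset.prod_eq_zero (Finset.mem_univ j) (if_neg hj.not_ge), ite_self]
    split_ifs <;> simp [hδ]

end Relations
end GeomBernoulli

open GeomBernoulli in
open Classical in
theorem proposition14 {n : ℕ} {V : Type*} [AddCommGroup V] [Module ℚ V]
    (B : Module.Basis (Fin n) ℚ V) (a : Fin (n + 1) → Module.Dual ℚ V)
    (ha : ∀ j, a j ∈ dualLattice B) (ha0 : ∀ j, a j ≠ 0) (v : V ⧸ lattice B) :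
    ((GeomBernoulli.rank a < n ∨ (GeomBernoulli.rank a = n ∧ 0 < kMinus a)) →
      ∑ j : Fin (n + 1), (-1) ^ (j : ℕ) * geometricBernoulli B (fun i => a (j.succAbove i)) v = 0) ∧
    (InGeneralPosition a → kMinus a = 0 →
      ∑ j : Fin (n + 1), (-1) ^ (j : ℕ) * geometricBernoulli B (fun i => a (j.succAbove i)) v =
        if v = 0 then ((signDet B (fun i : Fin n => a i.succ) : ℤ) : BernoulliFunctions n)
        else 0) := by
  refine ⟨?_, fun hgen hk => ?_⟩
  · rintro (hrank | ⟨hrank, hk⟩)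
    · refine Finset.sum_eq_zero fun j _ => ?_
      rw [geometricBernoulli, dif_neg, mul_zero]
      exact fun h => (le_rank_of_linearIndependent B a j h).not_gt hrank
    · have hc := standardRelation_spec hrank
      set c := standardRelation a
      obtain ⟨q, hq⟩ := exists_eq_smul_of_rank_eq hrank hc.ne_zero hc.relation
        (sum_det_smul_eq_zero B.dualBasis a)
      rw [sum_geometricBernoulli_eq B a v (congrFun hq)]
      rcases eq_or_ne q 0 with rfl | hq0
      · simp
      have hind : ∀ j, c j ≠ 0 → LinearIndependent ℚ fun i => a (j.succAbove i) := by
        intro j hj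
        rw [← det_ne_zero_iff_linearIndependent B]
        exact right_ne_zero_of_mul ((congrFun hq j).trans_ne (mul_ne_zero hq0 hj))
      obtain ⟨j, hj⟩ := numNeg_pos_iff.1 hk
      have hpos := numPos_pos_iff.1 (lt_of_lt_of_le hk hc.numNeg_le)
      have hP := coneIndicator_univ_regularizedSum B v hc.relation hpos
        fun j hj => hind j hj.ne'
      have hN := coneIndicator_univ_regularizedSum (c := fun j => -c j) B v
        (by simp [hc.relation]) ⟨j, neg_pos.2 hj⟩
        fun j hj => hind j (neg_pos.1 hj).ne
      rw [regularizedSums_unique hP hN, sub_self, mul_zero, map_zero, mul_zero]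
  · have : FiniteDimensional ℚ V := B.finiteDimensional_of_finite
    have hind := hgen.linearIndependent_succAbove B
    have hrank : GeomBernoulli.rank a = n := by
      refine le_antisymm ((Submodule.finrank_le _).trans_eq ?_)
        (le_rank_of_linearIndependent B a 0 (hind 0))
      rw [Subspace.dual_finrank_eq, finrank_eq_of_basis B]
    have hc := standardRelation_spec hrank
    set c := standardRelation a
    obtain ⟨q, hq⟩ := exists_eq_smul_of_rank_eq hrank hc.ne_zero hc.relation
      (sum_det_smul_eq_zero B.dualBasis a)
    have hc0 : ∀ j, c j ≠ 0 := fun j => right_ne_zero_of_mul ((congrFun hq j).symm.trans_ne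
      (mul_ne_zero (pow_ne_zero _ (by norm_num))
        ((det_ne_zero_iff_linearIndependent B _).2 (hind j))))
    have hpos : ∀ j, 0 < c j := fun j => (hc0 j).symm.lt_of_le (not_lt.1 fun hj =>
      (numNeg_pos_iff.2 ⟨j, hj⟩).ne' hk)
    have hsign : signDet B (fun i : Fin n => a i.succ) = SignType.sign q := by
      have h0 := congrFun hq 0
      simp only [Fin.val_zero, pow_zero, one_mul, Fin.succAbove_zero] at h0
      rw [signDet, h0, Pi.smul_apply, smul_eq_mul, sign_mul, sign_pos (hpos 0), mul_one]
    have hP := coneIndicator_univ_regularizedSum B v hc.relation ⟨0, hpos 0⟩ fun j _ => hind j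
    rw [coneIndicator_univ_of_pos B v hc.relation hpos (by simpa using hind 0)] at hP
    -- the regularized sum of a point, computed without a denominator
    have horigin : ((if v = 0 then Pi.single 0 1 else 0 : V → ℤ),
        (if v = 0 then PowerSeries.X ^ n else 0 : PowerSeries (BernoulliFunctions n))) ∈
        regularizedSums (expCharacter B) (PowerSeries.X ^ n) := by
      split_ifs
      · exact ⟨1, 1, by simp, rfl, by simp⟩
      · exact zero_mem _
    rw [sum_geometricBernoulli_eq B a v (congrFun hq), regularizedSums_unique hP horigin, hsign,
      Finset.filter_false_of_mem fun j _ => by simpa using (hpos j).le, Finset.sum_empty, sub_zero]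
    split_ifs
    · rw [PowerSeries.coeff_mul_X_pow', if_pos le_rfl]
      simp
    · simp
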